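/- Let $\gamma>0$ and let $(X,d,\mu)$ be an Ahlfors $\gamma$-regular space: $(X,d)$ is a metric space and $\mu$ is a Borel measure with $c_1r^\gamma\le\mu(B(x,r))\le c_2r^\gamma$ for some constants $c_1,c_2>0$, every $x\in X$ and every $r>0$, where $B(x,r)$ is the open ball. Let $\mathcal D=\bigcup_{j\in\mathbb Z}\mathcal D_j$ be a dyadic family on $X$, that is: for some $0<\nu<1$, every $Q\in\mathcal D_j$ has $\operatorname{diam}Q\simeq\nu^j$ and eccentricity $\simeq 1$, with constants independent of $j$ and $Q$ (the eccentricity of $Q$ is the supremum of $r_1/r_2$ over the balls $B(x_1,r_1)\subseteq Q\subseteq B(x_2,r_2)$); every $Q\in\mathcal D$ is a Borel set; each $\mathcal D_j$ is a partition of $X$; each $Q\in\mathcal D_{j+1}$ is contained in exactly one cube of $\mathcal D_j$; for some constant $M$, every $Q\in\mathcal D_j$ contains at least one and at most $M$ cubes of $\mathcal D_{j+1}$; two cubes of $\mathcal D$ are disjoint or one contains the other; and for every $Q\in\mathcal D$ the union of the cubes of $\mathcal D$ that contain $Q$ is $X$. Let $\delta(x,x)=0$ and $\delta(x,y)=\inf\{\mu(Q):Q\in\mathcal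 D,\ x,y\in Q\}$ for $x\ne y$. For $\sigma>0$ and $u\in L^2(X,\mu)$ (real valued) put $$\mathscr E^{d,\mu}_\sigma(u)=\iint_{X\times X}\frac{|u(x)-u(y)|^2}{\mu(B(x,d(x,y)))^{1+2\sigma}}\,d\mu(x)\,d\mu(y),\qquad \mathscr E^{\delta,\mu}_\sigma(u)=\iint_{X\times X}\frac{|u(x)-u(y)|^2}{\delta(x,y)^{1+2\sigma}}\,d\mu(x)\,d\mu(y),$$ both with values in $[0,\infty]$, and let $H^\sigma_{d,\mu}$ and $H^\sigma_{\delta,\mu}$ be the spaces of those $u\in L^2(X,\mu)$ for which the first, respectively the second, energy is finite, with the norms $\|u\|_{L^2}+\sqrt{\mathscr E^{d,\mu}_\sigma(u)}$ and $\|u\|_{L^2}+\sqrt{\mathscr E^{\delta,\mu}_\sigma(u)}$. Let $P_j$ be the orthogonal projector of $L^2(X,\mu)$ onto $V_j=\{f\in L^2(X,\mu): f|_Q\text{ is constant for every }Q\in\mathcal D_j\}$. A Hilbert subspace of one of these two spaces is a linear subspace that is complete for its norm; a Hilbert subspace $S$ of $H^\sigma_{d,\mu}$ is a space of coercivity for $\mathscr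 E^{d,\mu}_\sigma$ if there is $c>0$ with $\mathscr E^{d,\mu}_\sigma(u)\ge c\|u\|^2_{L^2}$ for all $u\in S$. Then, for every $\sigma>0$ and every $j\in\mathbb Z$: 1. $H^\sigma_{d,\mu}\subseteq H^\sigma_{\delta,\mu}$, and $H^\sigma_{\delta,\mu}\cap\operatorname{Ker}P_j$ is a Hilbert subspace of $H^\sigma_{\delta,\mu}$. 2. There is a constant $C>0$, depending on $j$ (and on $X,d,\mu,\mathcal D,\sigma$) but not on $u$, such that $\mathscr E^{d,\mu}_\sigma(u)\ge C\|u\|^2_{L^2}$ for every $u\in H^\sigma_{\delta,\mu}\cap\operatorname{Ker}P_j$ (where $\mathscr E^{d,\mu}_\sigma(u)$ may be $+\infty$). 3. $H^\sigma_{d,\mu}\cap\operatorname{Ker}P_j$ is a space of coercivity for $\mathscr E^{d,\mu}_\sigma$. -/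

import Mathlib

open MeasureTheory Filter Topology
open scoped ENNReal

noncomputable section

namespace DyadicCoercivity

variable {X : Type*}

/-- The measure `μ` is Ahlfors `γ`-regular: `c₁ r ^ γ ≤ μ (B(x, r)) ≤ c₂ r ^ γ` for all `x` and
all `r > 0`, with positive constants `c₁`, `c₂`. -/
def IsAhlforsRegular [MetricSpace X] [MeasurableSpace X] (μ : Measure X) (γ : ℝ) : Prop :=
  ∃ c₁ c₂ : ℝ, 0 < c₁ ∧ 0 < c₂ ∧ ∀ (x : X) (r : ℝ), 0 < r →
    ENNReal.ofReal (c₁ * r ^ γ) ≤ μ (Metric.ball x r) ∧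
      μ (Metric.ball x r) ≤ ENNReal.ofReal (c₂ * r ^ γ)

/-- The eccentricity of `Q`: the supremum of the quotients `r₁ / r₂` of the radii of balls
`B(x₁, r₁) ⊆ Q` and `B(x₂, r₂) ⊇ Q`. -/
def eccentricity [MetricSpace X] (Q : Set X) : ℝ≥0∞ :=
  sSup {t | ∃ (x₁ x₂ : X) (r₁ r₂ : ℝ), 0 < r₁ ∧ 0 < r₂ ∧
    Metric.ball x₁ r₁ ⊆ Q ∧ Q ⊆ Metric.ball x₂ r₂ ∧ t = ENNReal.ofReal (r₁ / r₂)}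

/-- `D j` is the family of the dyadic cubes of level `j`; smaller cubes have larger levels. -/
structure IsDyadicFamily [MetricSpace X] [MeasurableSpace X] (D : ℤ → Set (Set X)) : Prop where
  /-- Cubes of level `j` have diameter comparable to `ν ^ j`. -/
  diam : ∃ ν a b : ℝ, 0 < ν ∧ ν < 1 ∧ 0 < a ∧ 0 < b ∧ ∀ (j : ℤ), ∀ Q ∈ D j,
    ENNReal.ofReal (a * ν ^ j) ≤ Metric.ediam Q ∧ Metric.ediam Q ≤ ENNReal.ofReal (b * ν ^ j)
  /-- The eccentricity of all cubes is comparable to `1`. -/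
  ecc : ∃ a b : ℝ, 0 < a ∧ 0 < b ∧ ∀ (j : ℤ), ∀ Q ∈ D j,
    ENNReal.ofReal a ≤ eccentricity Q ∧ eccentricity Q ≤ ENNReal.ofReal b
  /-- Cubes are Borel sets. -/
  measurable : ∀ (j : ℤ), ∀ Q ∈ D j, MeasurableSet Q
  /-- The cubes of each level form a partition of the space. -/
  partition : ∀ j : ℤ, Setoid.IsPartition (D j)
  /-- Each cube has exactly one father. -/
  father : ∀ (j : ℤ), ∀ Q ∈ D (j + 1), ∃! Q' : Set X, Q' ∈ D j ∧ Q ⊆ Q'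
  /-- The number of children of a cube is at least `1` and is bounded. -/
  offspring : ∃ M : ℕ, ∀ (j : ℤ), ∀ Q ∈ D j,
    1 ≤ {Q' | Q' ∈ D (j + 1) ∧ Q' ⊆ Q}.encard ∧ {Q' | Q' ∈ D (j + 1) ∧ Q' ⊆ Q}.encard ≤ M
  /-- Two cubes are disjoint or nested. -/
  nested : ∀ (i j : ℤ), ∀ Q ∈ D i, ∀ Q' ∈ D j, Disjoint Q' Q ∨ Q' ⊆ Q ∨ Q ⊆ Q'
  /-- The whole space is a quadrant. -/
  quadrant : ∀ (j : ℤ), ∀ Q ∈ D j, ⋃₀ {Q' | (∃ i : ℤ, Q' ∈ D i) ∧ Q ⊆ Q'} = Set.univ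

/-- The dyadic distance `δ`: zero on the diagonal, and otherwise the infimum of the measures of
the cubes that contain both points. -/
def dyadicDist [MeasurableSpace X] (μ : Measure X) (D : ℤ → Set (Set X)) (x y : X) : ℝ≥0∞ :=
  open Classical in
  if x = y then 0 else sInf {t | ∃ (j : ℤ) (Q : Set X), Q ∈ D j ∧ x ∈ Q ∧ y ∈ Q ∧ t = μ Q}

/-- The energy `∬ |u(x) - u(y)|² / K(x, y) ^ (1 + 2σ) dμ(y) dμ(x)` with values in `[0, ∞]`. -/
def energy [MeasurableSpace X] (μ : Measure X) (K : X → X → ℝ≥0∞) (σ : ℝ) (u : X → ℝ) : ℝ≥0∞ :=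
  ∫⁻ x, ∫⁻ y, ‖u x - u y‖ₑ ^ 2 / (K x y) ^ (1 + 2 * σ) ∂μ ∂μ

/-- The energy of the metric measure space: the kernel is `μ (B(x, d(x, y)))`. -/
def metricEnergy [MetricSpace X] [MeasurableSpace X] (μ : Measure X) (σ : ℝ)
    (u : Lp ℝ 2 μ) : ℝ≥0∞ :=
  energy μ (fun x y => μ (Metric.ball x (dist x y))) σ u

/-- The dyadic energy: the kernel is the dyadic distance. -/
def dyadicEnergy [MeasurableSpace X] (μ : Measure X) (D : ℤ → Set (Set X)) (σ : ℝ)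
    (u : Lp ℝ 2 μ) : ℝ≥0∞ :=
  energy μ (dyadicDist μ D) σ u

/-- The space of the functions in `L²` of finite energy `E`. -/
def finiteEnergy [MeasurableSpace X] {μ : Measure X} (E : Lp ℝ 2 μ → ℝ≥0∞) : Set (Lp ℝ 2 μ) :=
  {u | E u < ∞}

/-- The norm `‖u‖_{L²} + √E(u)`. -/
def energyNorm [MeasurableSpace X] {μ : Measure X} (E : Lp ℝ 2 μ → ℝ≥0∞) (u : Lp ℝ 2 μ) : ℝ≥0∞ :=
  ‖u‖ₑ + E u ^ (1 / 2 : ℝ)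

/-- `S` is a Hilbert subspace of the space of finite energy: a linear subspace which is complete
for the norm `‖u‖_{L²} + √E(u)`. -/
structure IsHilbertSubspace [MeasurableSpace X] {μ : Measure X} (E : Lp ℝ 2 μ → ℝ≥0∞)
    (S : Set (Lp ℝ 2 μ)) : Prop where
  subset : S ⊆ finiteEnergy E
  linear : ∃ V : Submodule ℝ (Lp ℝ 2 μ), (V : Set (Lp ℝ 2 μ)) = S
  complete : ∀ f : ℕ → Lp ℝ 2 μ, (∀ n, f n ∈ S) →
    (∀ ε : ℝ≥0∞, 0 < ε → ∃ N, ∀ m ≥ N, ∀ n ≥ N, energyNorm E (f m - f n) < ε) →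
    ∃ u ∈ S, Tendsto (fun n => energyNorm E (f n - u)) atTop (𝓝 0)

/-- The inequality `E(u) ≥ c ‖u‖²_{L²}` on `S`, with a constant `c > 0`. -/
def IsCoerciveOn [MeasurableSpace X] {μ : Measure X} (E : Lp ℝ 2 μ → ℝ≥0∞)
    (S : Set (Lp ℝ 2 μ)) : Prop :=
  ∃ c : ℝ, 0 < c ∧ ∀ u ∈ S, ENNReal.ofReal (c * ‖u‖ ^ 2) ≤ E u

/-- A space of coercivity for `E`. -/
def IsCoercivitySpace [MeasurableSpace X] {μ : Measure X} (E : Lp ℝ 2 μ → ℝ≥0∞)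
    (S : Set (Lp ℝ 2 μ)) : Prop :=
  IsHilbertSubspace E S ∧ IsCoerciveOn E S

/-- The space `V_j` of the functions in `L²` that are constant on every cube of level `j`. -/
def levelSpace [MeasurableSpace X] (μ : Measure X) (D : ℤ → Set (Set X)) (j : ℤ) :
    Submodule ℝ (Lp ℝ 2 μ) where
  carrier := {f | ∀ Q ∈ D j, ∃ c : ℝ, ∀ᵐ x ∂(μ.restrict Q), f x = c}
  zero_mem' := fun Q _ => ⟨0, ae_restrict_of_ae (Lp.coeFn_zero ℝ 2 μ)⟩
  add_mem' := by
    intro f g hf hg Q hQ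
    obtain ⟨a, ha⟩ := hf Q hQ
    obtain ⟨b, hb⟩ := hg Q hQ
    refine ⟨a + b, ?_⟩
    filter_upwards [ha, hb, ae_restrict_of_ae (Lp.coeFn_add f g)] with x h1 h2 h3
    rw [h3, Pi.add_apply, h1, h2]
  smul_mem' := by
    intro r f hf Q hQ
    obtain ⟨a, ha⟩ := hf Q hQ
    refine ⟨r * a, ?_⟩
    filter_upwards [ha, ae_restrict_of_ae (Lp.coeFn_smul r f)] with x h1 h2
    rw [h2, Pi.smul_apply, h1, smul_eq_mul]

theorem isClosed_levelSpace [MeasurableSpace X] (μ : Measure X) (D : ℤ → Set (Set X)) (j : ℤ) :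
    IsClosed (levelSpace μ D j : Set (Lp ℝ 2 μ)) := by
  refine IsSeqClosed.isClosed ?_
  intro f g hf hfg Q hQ
  obtain ⟨ns, -, hns⟩ := (tendstoInMeasure_of_tendsto_Lp hfg).exists_seq_tendsto_ae
  have hc : ∀ k, ∃ c : ℝ, ∀ᵐ x ∂(μ.restrict Q), f (ns k) x = c := fun k => hf (ns k) Q hQ
  choose c hc using hc
  have h1 : ∀ᵐ x ∂(μ.restrict Q), Tendsto c atTop (𝓝 (g x)) := by
    filter_upwards [ae_restrict_of_ae hns, ae_all_iff.2 hc] with x hx h2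
    simpa only [h2] using hx
  by_cases h0 : ae (μ.restrict Q) = ⊥
  · exact ⟨0, by simp [Filter.Eventually, h0]⟩
  · have : (ae (μ.restrict Q)).NeBot := ⟨h0⟩
    obtain ⟨x₀, hx₀⟩ := h1.exists
    refine ⟨g x₀, ?_⟩
    filter_upwards [h1] with x hx
    exact tendsto_nhds_unique hx hx₀

instance [MeasurableSpace X] (μ : Measure X) (D : ℤ → Set (Set X)) (j : ℤ) :
    CompleteSpace (levelSpace μ D j) :=
  (isClosed_levelSpace μ D j).completeSpace_coe

/-- The orthogonal projector `P_j` of `L²` onto `V_j`. -/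
def levelProj [MeasurableSpace X] (μ : Measure X) (D : ℤ → Set (Set X)) (j : ℤ) :
    Lp ℝ 2 μ →L[ℝ] Lp ℝ 2 μ :=
  (levelSpace μ D j).starProjection

/-- The kernel of `P_j`. -/
def levelKer [MeasurableSpace X] (μ : Measure X) (D : ℤ → Set (Set X)) (j : ℤ) :
    Set (Lp ℝ 2 μ) :=
  {u | levelProj μ D j u = 0}

end DyadicCoercivity

end

/-!
A function `u` in `Ker P_j` has mean zero on every cube `Q` of level `j`, so that
`∫_Q |u(x) - u(y)|² dμ(y) ≥ μ(Q) |u(x)|²` for every `x`. Since `δ ≤ μ(Q)` on `Q × Q` and the cubes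
of level `j` have measure at most some `M < ∞`, integrating over `x` gives the coercivity of the
dyadic energy, with constant `M ^ (-2σ)`.

A cube `Q` of eccentricity bounded below contains a ball of radius comparable to its diameter, so
that `μ(B(x, d(x, y))) ≤ C μ(Q)` for `x, y ∈ Q`, and hence `μ(B(x, d(x, y))) ≤ C δ(x, y)`. The
dyadic energy is therefore at most a multiple of the energy of the metric, which gives the
inclusion of the spaces and transfers the coercivity.

An energy is the squared `L²` norm of the increment `u(x) - u(y)` for a weighted product measure.
By Fatou's lemma it is lower semicontinuous on `L²`, and a Cauchy sequence for the energy norm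
converges to its `L²` limit in that norm as well; the intersection with the closed subspace
`Ker P_j` is therefore complete.
-/

namespace DyadicCoercivity

open Set Metric Function

section Increment

variable {X : Type*}

/-- The increment `(x, y) ↦ u x - u y` of a function. -/
def increment (u : X → ℝ) (p : X × X) : ℝ :=
  u p.1 - u p.2

theorem increment_zero : increment (0 : X → ℝ) = 0 := by
  ext z
  simp only [increment, Pi.zero_apply, sub_zero]

theorem increment_add (u v : X → ℝ) : increment (u + v) = increment u + increment v := by
  ext z
  simp only [increment, Pi.add_apply]
  ring

theorem increment_smul (c : ℝ) (u : X → ℝ) : increment (c • u) = c • increment u := by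
  ext z
  simp only [increment, Pi.smul_apply, smul_eq_mul, mul_sub]

variable [MeasurableSpace X] {μ : Measure X} {K : X → X → ℝ≥0∞} {σ : ℝ}

/-- The weighted product measure `K ^ (-(1 + 2σ)) d(μ ⊗ μ)`, for which the energy of `u` is the
square of the `L²` norm of its increment. -/
noncomputable def energyMeasure (μ : Measure X) (K : X → X → ℝ≥0∞) (σ : ℝ) : Measure (X × X) :=
  (μ.prod μ).withDensity fun p => (K p.1 p.2 ^ (1 + 2 * σ))⁻¹

theorem measurable_increment {u : X → ℝ} (hu : Measurable u) : Measurable (increment u) :=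
  (hu.comp measurable_fst).sub (hu.comp measurable_snd)

theorem eLpNorm_two_sq {Y : Type*} [MeasurableSpace Y] (ν : Measure Y) (f : Y → ℝ) :
    eLpNorm f 2 ν ^ 2 = ∫⁻ y, ‖f y‖ₑ ^ 2 ∂ν := by
  simpa using eLpNorm_nnreal_pow_eq_lintegral (f := f) (μ := ν) (p := 2) two_ne_zero

theorem energy_eq_eLpNorm_sq [SFinite μ] (hK : Measurable (uncurry K)) {u : X → ℝ}
    (hu : Measurable u) :
    energy μ K σ u = eLpNorm (increment u) 2 (energyMeasure μ K σ) ^ 2 := by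
  have hweight : Measurable fun p : X × X => (K p.1 p.2 ^ (1 + 2 * σ))⁻¹ :=
    (hK.pow_const _).inv
  have hincr : Measurable fun p => ‖increment u p‖ₑ ^ 2 :=
    (measurable_increment hu).enorm.pow_const 2
  rw [eLpNorm_two_sq, energyMeasure, lintegral_withDensity_eq_lintegral_mul _ hweight hincr,
    lintegral_prod _ (hweight.mul hincr).aemeasurable]
  simp only [energy, increment, Pi.mul_apply, div_eq_mul_inv, mul_comm]

theorem ae_energyMeasure_of_ae [SFinite μ] {p : X → Prop} (h : ∀ᵐ x ∂μ, p x) :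
    ∀ᵐ z ∂energyMeasure μ K σ, p z.1 ∧ p z.2 :=
  (withDensity_absolutelyContinuous _ _).ae_le <|
    (Measure.quasiMeasurePreserving_fst.ae h).and (Measure.quasiMeasurePreserving_snd.ae h)

theorem increment_congr_ae [SFinite μ] {u v : X → ℝ} (h : u =ᵐ[μ] v) :
    increment u =ᵐ[energyMeasure μ K σ] increment v := by
  filter_upwards [ae_energyMeasure_of_ae h] with z hz
  rw [increment, increment, hz.1, hz.2]

theorem aestronglyMeasurable_increment (u : Lp ℝ 2 μ) (ν : Measure (X × X)) :
    AEStronglyMeasurable (increment u) ν :=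
  (measurable_increment (Lp.stronglyMeasurable u).measurable).aestronglyMeasurable

/-- The space of the functions in `L²` whose increment is square integrable for the measure
`energyMeasure μ K σ`; it is the space of finite energy with its linear structure. -/
noncomputable def energySpace (μ : Measure X) [SFinite μ] (K : X → X → ℝ≥0∞) (σ : ℝ) :
    Submodule ℝ (Lp ℝ 2 μ) where
  carrier := {u | MemLp (increment u) 2 (energyMeasure μ K σ)}
  zero_mem' := (memLp_congr_ae (increment_congr_ae (Lp.coeFn_zero ℝ 2 μ))).2
    (increment_zero (X := X) ▸ MemLp.zero)
  add_mem' {u v} hu hv := (memLp_congr_ae (increment_congr_ae (Lp.coeFn_add u v))).2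
    (increment_add u v ▸ hu.add hv)
  smul_mem' c u hu := (memLp_congr_ae (increment_congr_ae (Lp.coeFn_smul c u))).2
    (increment_smul c u ▸ hu.const_smul c)

theorem coe_energySpace [SFinite μ] (hK : Measurable (uncurry K)) :
    (energySpace μ K σ : Set (Lp ℝ 2 μ)) = finiteEnergy fun u => energy μ K σ u := by
  ext u
  change MemLp _ _ _ ↔ energy μ K σ u < ∞
  rw [energy_eq_eLpNorm_sq hK (Lp.stronglyMeasurable u).measurable]
  simp [MemLp, aestronglyMeasurable_increment]

theorem energyNorm_eq [SFinite μ] (hK : Measurable (uncurry K)) (u : Lp ℝ 2 μ) :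
    energyNorm (fun u : Lp ℝ 2 μ => energy μ K σ u) u =
      ‖u‖ₑ + eLpNorm (increment u) 2 (energyMeasure μ K σ) := by
  rw [energyNorm, energy_eq_eLpNorm_sq hK (Lp.stronglyMeasurable u).measurable,
    ← ENNReal.rpow_natCast, ← ENNReal.rpow_mul]
  norm_num

theorem lowerSemicontinuous_eLpNorm_increment [SFinite μ] :
    LowerSemicontinuous fun u : Lp ℝ 2 μ => eLpNorm (increment u) 2 (energyMeasure μ K σ) := by
  refine lowerSemicontinuous_iff_isClosed_preimage.2 fun C => IsSeqClosed.isClosed ?_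
  intro f u hf hfu
  obtain ⟨ns, -, hae⟩ := (tendstoInMeasure_of_tendsto_Lp hfu).exists_seq_tendsto_ae
  refine Lp.eLpNorm_le_of_ae_tendsto (u := atTop) (Eventually.of_forall fun k => hf (ns k))
    (fun k => aestronglyMeasurable_increment (f (ns k)) _) ?_
  filter_upwards [ae_energyMeasure_of_ae hae] with z hz
  exact hz.1.sub hz.2

theorem tendsto_eLpNorm_increment_sub [SFinite μ] {f : ℕ → Lp ℝ 2 μ} {u : Lp ℝ 2 μ}
    (hfu : Tendsto f atTop (𝓝 u))
    (hf : ∀ ε : ℝ≥0∞, 0 < ε → ∃ N, ∀ m ≥ N, ∀ n ≥ N,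
      eLpNorm (increment ((f m - f n : Lp ℝ 2 μ))) 2 (energyMeasure μ K σ) ≤ ε) :
    Tendsto (fun n => eLpNorm (increment ((f n - u : Lp ℝ 2 μ))) 2 (energyMeasure μ K σ))
      atTop (𝓝 0) := by
  refine ENNReal.tendsto_atTop_zero.2 fun ε hε => ?_
  obtain ⟨N, hN⟩ := hf ε hε
  refine ⟨N, fun m hm => ?_⟩
  exact (lowerSemicontinuous_eLpNorm_increment.isClosed_preimage ε).mem_of_tendsto
    (hfu.const_sub (f m)) ((eventually_ge_atTop N).mono fun n hn => hN m hm n hn)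

theorem isHilbertSubspace_finiteEnergy_inter [SFinite μ] (hK : Measurable (uncurry K))
    {V : Submodule ℝ (Lp ℝ 2 μ)} (hV : IsClosed (V : Set (Lp ℝ 2 μ))) :
    IsHilbertSubspace (fun u : Lp ℝ 2 μ => energy μ K σ u)
      (finiteEnergy (fun u : Lp ℝ 2 μ => energy μ K σ u) ∩ V) := by
  rw [← coe_energySpace hK]
  refine ⟨inter_subset_left.trans (coe_energySpace hK).subset, ⟨energySpace μ K σ ⊓ V, rfl⟩, ?_⟩
  intro f hf hcauchy
  simp only [energyNorm_eq hK] at hcauchy ⊢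
  have hcauchyL2 : CauchySeq f := EMetric.cauchySeq_iff.2 fun ε hε =>
    (hcauchy ε hε).imp fun N hN m hm n hn => by
      rw [edist_eq_enorm_sub]
      exact le_self_add.trans_lt (hN m hm n hn)
  obtain ⟨u, hu⟩ := cauchySeq_tendsto_of_complete hcauchyL2
  have hincr := tendsto_eLpNorm_increment_sub hu fun ε hε =>
    (hcauchy ε hε).imp fun N hN m hm n hn => le_add_self.trans (hN m hm n hn).le
  have hnorm : Tendsto (fun n => ‖f n - u‖ₑ) atTop (𝓝 0) := by
    simpa only [edist_eq_enorm_sub] using tendsto_iff_edist_tendsto_0.1 hu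
  have hu_mem : u ∈ energySpace μ K σ := by
    obtain ⟨n, hn⟩ := (hincr.eventually_lt_const ENNReal.zero_lt_top).exists
    have hdiff : f n - u ∈ energySpace μ K σ := ⟨aestronglyMeasurable_increment _ _, hn⟩
    simpa using (energySpace μ K σ).sub_mem (hf n).1 hdiff
  exact ⟨u, ⟨hu_mem, hV.mem_of_tendsto hu (Eventually.of_forall fun n => (hf n).2)⟩,
    by simpa using hnorm.add hincr⟩

end Increment

section Comparison

variable {X : Type*} [MeasurableSpace X] {μ : Measure X}

theorem energy_le_mul_energy {K K' : X → X → ℝ≥0∞} {σ : ℝ} (hσ : 0 ≤ 1 + 2 * σ) {C : ℝ≥0∞}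
    (hC₀ : C ≠ 0) (hC : C ≠ ∞) (h : ∀ x y, K x y ≤ C * K' x y) (u : X → ℝ) :
    energy μ K' σ u ≤ C ^ (1 + 2 * σ) * energy μ K σ u := by
  set p := 1 + 2 * σ with hp
  have hCp : C ^ p ≠ ∞ := ENNReal.rpow_ne_top_of_nonneg hσ hC
  have hCp₀ : C ^ p ≠ 0 := (ENNReal.rpow_pos (pos_iff_ne_zero.2 hC₀) hC).ne'
  have hweight : ∀ x y, (K' x y ^ p)⁻¹ ≤ C ^ p * (K x y ^ p)⁻¹ := fun x y => by
    rw [← ENNReal.div_le_iff' hCp₀ hCp, div_eq_mul_inv, mul_comm,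
      ← ENNReal.mul_inv (Or.inl hCp₀) (Or.inl hCp), ← ENNReal.mul_rpow_of_nonneg _ _ hσ]
    exact ENNReal.inv_le_inv.2 (ENNReal.rpow_le_rpow (h x y) hσ)
  simp only [energy, ← hp, ← lintegral_const_mul' _ _ hCp]
  refine lintegral_mono fun x => lintegral_mono fun y => ?_
  rw [div_eq_mul_inv, div_eq_mul_inv, mul_left_comm]
  exact mul_le_mul_right (hweight x y) _

variable {E E' : Lp ℝ 2 μ → ℝ≥0∞} {S T : Set (Lp ℝ 2 μ)} {C : ℝ≥0∞}

theorem finiteEnergy_subset_of_le_mul (hC : C ≠ ∞) (h : ∀ u, E u ≤ C * E' u) :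
    finiteEnergy E' ⊆ finiteEnergy E :=
  fun u hu => (h u).trans_lt (ENNReal.mul_lt_top hC.lt_top hu)

theorem isCoerciveOn_of_mul_enorm_sq_le {c : ℝ≥0∞} (hc : c ≠ 0)
    (h : ∀ u ∈ S, c * ‖u‖ₑ ^ 2 ≤ E u) : IsCoerciveOn E S := by
  have hmin : min c 1 ≠ ∞ := (min_lt_of_right_lt ENNReal.one_lt_top).ne
  refine ⟨(min c 1).toReal, ENNReal.toReal_pos (by simp [hc]) hmin, fun u hu => ?_⟩
  rw [ENNReal.ofReal_mul ENNReal.toReal_nonneg, ENNReal.ofReal_toReal hmin,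
    ENNReal.ofReal_pow (norm_nonneg _), ofReal_norm]
  exact (mul_le_mul_left (min_le_left c 1) _).trans (h u hu)

theorem IsCoerciveOn.mono (h : IsCoerciveOn E T) (hST : S ⊆ T) : IsCoerciveOn E S :=
  h.imp fun _ hc => ⟨hc.1, fun u hu => hc.2 u (hST hu)⟩

theorem IsCoerciveOn.of_le_mul (hE : IsCoerciveOn E S) (hC : C ≠ ∞) (h : ∀ u, E u ≤ C * E' u) :
    IsCoerciveOn E' S := by
  obtain ⟨c, hc, hcE⟩ := hE
  have hcC : ENNReal.ofReal c / C ≠ 0 := ENNReal.div_ne_zero.2 ⟨by simpa using hc, hC⟩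
  refine isCoerciveOn_of_mul_enorm_sq_le hcC fun u hu => ?_
  rw [← ENNReal.mul_div_right_comm]
  refine ENNReal.div_le_of_le_mul' ?_
  rw [← ofReal_norm, ← ENNReal.ofReal_pow (norm_nonneg _), ← ENNReal.ofReal_mul hc.le]
  exact (hcE u hu).trans (h u)

end Comparison

section MeanZero

variable {X : Type*} [MeasurableSpace X] {μ : Measure X}

theorem setIntegral_eq_zero_of_mem_levelKer {D : ℤ → Set (Set X)} {j : ℤ}
    (hdisj : (D j).PairwiseDisjoint id) (hmeas : ∀ Q ∈ D j, MeasurableSet Q) {u : Lp ℝ 2 μ}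
    (hu : u ∈ levelKer μ D j) {Q : Set X} (hQ : Q ∈ D j) (hfin : μ Q ≠ ∞) :
    ∫ y in Q, u y ∂μ = 0 := by
  set f : Lp ℝ 2 μ := indicatorConstLp 2 (hmeas Q hQ) hfin (1 : ℝ)
  have hf : f ∈ levelSpace μ D j := by
    intro P hP
    have hfP : ∀ᵐ x ∂μ.restrict P, f x = Q.indicator (fun _ => 1) x :=
      ae_restrict_of_ae indicatorConstLp_coeFn
    rcases eq_or_ne P Q with rfl | hPQ
    · refine ⟨1, ?_⟩
      filter_upwards [hfP, ae_restrict_mem (hmeas P hP)] with x hfx hx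
      rw [hfx, indicator_of_mem hx]
    · refine ⟨0, ?_⟩
      filter_upwards [hfP, ae_restrict_mem (hmeas P hP)] with x hfx hx
      have hxQ : x ∉ Q := disjoint_left.1 (hdisj hP hQ hPQ) hx
      rw [hfx, indicator_of_notMem hxQ]
  have huf : inner ℝ u f = 0 :=
    Submodule.inner_left_of_mem_orthogonal hf <|
      (levelSpace μ D j).starProjection_apply_eq_zero_iff.1 hu
  rwa [real_inner_comm, L2.inner_indicatorConstLp_one] at huf

theorem measure_univ_mul_enorm_sq_le_lintegral [IsFiniteMeasure μ] {u : X → ℝ}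
    (hu : MemLp u 2 μ) (hmean : ∫ y, u y ∂μ = 0) (t : ℝ) :
    μ univ * ‖t‖ₑ ^ 2 ≤ ∫⁻ y, ‖t - u y‖ₑ ^ 2 ∂μ := by
  have hint : Integrable u μ := hu.integrable one_le_two
  have hsq : Integrable (fun y => (t - u y) ^ 2) μ := ((memLp_const t).sub hu).integrable_sq
  have enorm_sq : ∀ s : ℝ, ‖s‖ₑ ^ 2 = ENNReal.ofReal (s ^ 2) := fun s => by
    rw [← enorm_pow, Real.enorm_of_nonneg (sq_nonneg s)]
  simp only [enorm_sq]
  rw [← ofReal_integral_eq_lintegral_ofReal hsq (ae_of_all _ fun y => sq_nonneg _),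
    ← ofReal_measureReal, ← ENNReal.ofReal_mul measureReal_nonneg]
  refine ENNReal.ofReal_le_ofReal ?_
  calc μ.real univ * t ^ 2 = ∫ y, (t ^ 2 - 2 * t * u y) ∂μ := by
        rw [integral_sub (integrable_const _) (hint.const_mul _), integral_const_mul, hmean]
        simp
    _ ≤ ∫ y, (t - u y) ^ 2 ∂μ :=
        integral_mono ((integrable_const _).sub (hint.const_mul _)) hsq fun y => by
          nlinarith [sq_nonneg (u y)]

theorem measure_rpow_mul_enorm_sq_le_setLIntegral {Q : Set X} (hQ : MeasurableSet Q)
    (hQ₀ : μ Q ≠ 0) (hfin : μ Q ≠ ∞) {σ : ℝ} (hσ : 0 ≤ 1 + 2 * σ) {k : X → ℝ≥0∞}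
    (hk : ∀ y ∈ Q, k y ≤ μ Q) {u : X → ℝ} (hu : MemLp u 2 (μ.restrict Q))
    (hmean : ∫ y in Q, u y ∂μ = 0) (t : ℝ) :
    μ Q ^ (-(2 * σ)) * ‖t‖ₑ ^ 2 ≤ ∫⁻ y in Q, ‖t - u y‖ₑ ^ 2 / k y ^ (1 + 2 * σ) ∂μ := by
  have : IsFiniteMeasure (μ.restrict Q) := ⟨by simpa using hfin.lt_top⟩
  have hweight : (μ Q ^ (1 + 2 * σ))⁻¹ ≠ ∞ :=
    ENNReal.inv_ne_top.2 (ENNReal.rpow_pos (pos_iff_ne_zero.2 hQ₀) hfin).ne'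
  have hpow : μ Q ^ (-(2 * σ)) = (μ Q ^ (1 + 2 * σ))⁻¹ * μ Q := by
    conv_rhs => rw [← ENNReal.rpow_neg, ← ENNReal.rpow_one (μ Q), ← ENNReal.rpow_mul,
      ← ENNReal.rpow_add _ _ (by simpa) (by simpa)]
    ring_nf
  calc μ Q ^ (-(2 * σ)) * ‖t‖ₑ ^ 2
      = (μ Q ^ (1 + 2 * σ))⁻¹ * (μ.restrict Q univ * ‖t‖ₑ ^ 2) := by
        rw [hpow, mul_assoc, Measure.restrict_apply_univ]
    _ ≤ (μ Q ^ (1 + 2 * σ))⁻¹ * ∫⁻ y in Q, ‖t - u y‖ₑ ^ 2 ∂μ :=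
        mul_le_mul_right (measure_univ_mul_enorm_sq_le_lintegral hu hmean t) _
    _ = ∫⁻ y in Q, ‖t - u y‖ₑ ^ 2 / μ Q ^ (1 + 2 * σ) ∂μ := by
        rw [← lintegral_const_mul' _ _ hweight]
        simp only [div_eq_mul_inv, mul_comm]
    _ ≤ ∫⁻ y in Q, ‖t - u y‖ₑ ^ 2 / k y ^ (1 + 2 * σ) ∂μ :=
        setLIntegral_mono' hQ fun y hy =>
          ENNReal.div_le_div_left (ENNReal.rpow_le_rpow (hk y hy) hσ) _

end MeanZero

section DyadicDist

variable {X : Type*} [MeasurableSpace X] {μ : Measure X} {D : ℤ → Set (Set X)} {x y : X}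

theorem dyadicDist_le_measure {j : ℤ} {Q : Set X} (hQ : Q ∈ D j) (hx : x ∈ Q) (hy : y ∈ Q) :
    dyadicDist μ D x y ≤ μ Q := by
  unfold dyadicDist
  split_ifs
  · exact zero_le
  · exact sInf_le ⟨j, Q, hQ, hx, hy, rfl⟩

theorem le_mul_dyadicDist (hxy : x ≠ y) {t C : ℝ≥0∞} (hC₀ : C ≠ 0) (hC : C ≠ ∞)
    (h : ∀ j, ∀ Q ∈ D j, x ∈ Q → y ∈ Q → t ≤ C * μ Q) : t ≤ C * dyadicDist μ D x y := by
  rw [dyadicDist, if_neg hxy, ← ENNReal.div_le_iff' hC₀ hC]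
  refine le_sInf ?_
  rintro _ ⟨j, Q, hQ, hx, hy, rfl⟩
  exact (ENNReal.div_le_iff' hC₀ hC).2 (h j Q hQ hx hy)

theorem measurable_dyadicDist [MeasurableEq X] (hcount : ∀ j, (D j).Countable)
    (hmeas : ∀ j, ∀ Q ∈ D j, MeasurableSet Q) : Measurable (uncurry (dyadicDist μ D)) := by
  classical
  have hinf : uncurry (dyadicDist μ D) = fun p : X × X =>
      if p.1 = p.2 then 0 else ⨅ j, ⨅ Q ∈ D j, if p ∈ Q ×ˢ Q then μ Q else ∞ := by
    ext ⟨x, y⟩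
    simp only [uncurry, dyadicDist]
    congr 1
    refine le_antisymm (le_iInf fun j => le_iInf₂ fun Q hQ => ?_) (le_sInf ?_)
    · split_ifs with h
      · exact sInf_le ⟨j, Q, hQ, h.1, h.2, rfl⟩
      · exact le_top
    · rintro _ ⟨j, Q, hQ, hx, hy, rfl⟩
      exact (iInf_le _ j).trans ((iInf₂_le Q hQ).trans_eq (if_pos ⟨hx, hy⟩))
  rw [hinf]
  refine Measurable.ite measurableSet_diagonal measurable_const ?_
  exact Measurable.iInf fun j => Measurable.biInf _ (hcount j) fun Q hQ =>
    Measurable.ite ((hmeas j Q hQ).prod (hmeas j Q hQ)) measurable_const measurable_const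

theorem isCoerciveOn_dyadicEnergy {j : ℤ} {σ : ℝ} (hσ : 0 ≤ σ) (hpart : Setoid.IsPartition (D j))
    (hmeas : ∀ Q ∈ D j, MeasurableSet Q) (hpos : ∀ Q ∈ D j, μ Q ≠ 0) {M : ℝ≥0∞} (hM : M ≠ ∞)
    (hQM : ∀ Q ∈ D j, μ Q ≤ M) : IsCoerciveOn (dyadicEnergy μ D σ) (levelKer μ D j) := by
  have hc : M ^ (-(2 * σ)) ≠ 0 := by
    rw [ENNReal.rpow_neg]
    exact ENNReal.inv_ne_zero.2 (ENNReal.rpow_ne_top_of_nonneg (by positivity) hM)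
  refine isCoerciveOn_of_mul_enorm_sq_le hc fun u hu => ?_
  have hu_meas : Measurable u := (Lp.stronglyMeasurable u).measurable
  rw [Lp.enorm_def, eLpNorm_two_sq, ← lintegral_const_mul _ (hu_meas.enorm.pow_const 2)]
  refine lintegral_mono fun x => ?_
  obtain ⟨Q, ⟨hQ, hx⟩, -⟩ := hpart.2 x
  have hfin : μ Q ≠ ∞ := ne_top_of_le_ne_top hM (hQM Q hQ)
  calc M ^ (-(2 * σ)) * ‖u x‖ₑ ^ 2 ≤ μ Q ^ (-(2 * σ)) * ‖u x‖ₑ ^ 2 := by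
        rw [ENNReal.rpow_neg, ENNReal.rpow_neg]
        gcongr
        exact hQM Q hQ
    _ ≤ ∫⁻ y in Q, ‖u x - u y‖ₑ ^ 2 / dyadicDist μ D x y ^ (1 + 2 * σ) ∂μ :=
        measure_rpow_mul_enorm_sq_le_setLIntegral (hmeas Q hQ) (hpos Q hQ) hfin (by positivity)
          (fun y hy => dyadicDist_le_measure hQ hx hy) ((Lp.memLp u).restrict Q)
          (setIntegral_eq_zero_of_mem_levelKer hpart.pairwiseDisjoint hmeas hu hQ hfin) (u x)
    _ ≤ ∫⁻ y, ‖u x - u y‖ₑ ^ 2 / dyadicDist μ D x y ^ (1 + 2 * σ) ∂μ :=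
        setLIntegral_le_lintegral Q _

end DyadicDist

section Geometry

variable {X : Type*} [MetricSpace X]

theorem exists_balls_of_lt_eccentricity {a : ℝ} {Q : Set X}
    (h : ENNReal.ofReal a < eccentricity Q) : ∃ (x₁ x₂ : X) (r₁ r₂ : ℝ), 0 < r₁ ∧ 0 < r₂ ∧
      ball x₁ r₁ ⊆ Q ∧ Q ⊆ ball x₂ r₂ ∧ a * r₂ < r₁ := by
  obtain ⟨_, ⟨x₁, x₂, r₁, r₂, hr₁, hr₂, hsub, hsup, rfl⟩, hlt⟩ := lt_sSup_iff.1 h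
  exact ⟨x₁, x₂, r₁, r₂, hr₁, hr₂, hsub, hsup,
    (lt_div_iff₀ hr₂).1 ((ENNReal.ofReal_lt_ofReal_iff (by positivity)).1 hlt)⟩

theorem interior_nonempty_of_eccentricity_ne_zero {Q : Set X} (h : eccentricity Q ≠ 0) :
    (interior Q).Nonempty := by
  obtain ⟨x, -, r, -, hr, -, hsub, -⟩ := exists_balls_of_lt_eccentricity (a := 0) (Q := Q)
    (by simpa using pos_iff_ne_zero.2 h)
  exact ⟨x, interior_maximal hsub isOpen_ball (mem_ball_self hr)⟩

theorem secondCountableTopology_of_isOpenPosMeasure {Y : Type*} [PseudoMetricSpace Y]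
    [MeasurableSpace Y] [OpensMeasurableSpace Y] (ν : Measure Y) [SFinite ν]
    [ν.IsOpenPosMeasure] : SecondCountableTopology Y := by
  refine Metric.secondCountable_of_almost_dense_set fun ε hε => ?_
  -- The centres of a maximal disjoint family of balls of radius `ε / 5` are `ε`-dense, and the
  -- family is countable because its members have positive measure.
  obtain ⟨s, -, hdisj, hcover⟩ := Vitali.exists_disjoint_subfamily_covering_enlargement_closedBall
    univ (id : Y → Y) (fun _ => ε / 5) (ε / 5) (fun _ _ => le_rfl) 5 (by norm_num)
  have hcount := Measure.countable_meas_pos_of_disjoint_iUnion (μ := ν)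
    (As := fun y : s => closedBall (y : Y) (ε / 5)) (fun _ => measurableSet_closedBall)
    (fun y z hyz => hdisj y.2 z.2 (Subtype.coe_ne_coe.2 hyz))
  have hpos : {y : s | 0 < ν (closedBall (y : Y) (ε / 5))} = univ :=
    eq_univ_of_forall fun y => measure_closedBall_pos ν (y : Y) (by positivity)
  rw [hpos, countable_univ_iff, countable_coe_iff] at hcount
  refine ⟨s, hcount, fun x => ?_⟩
  obtain ⟨y, hy, hxy⟩ := hcover x (mem_univ x)
  refine ⟨y, hy, ?_⟩
  have hx : dist x y ≤ 5 * (ε / 5) := hxy (mem_closedBall_self (by positivity))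
  linarith

variable [MeasurableSpace X] {μ : Measure X} {γ : ℝ}

theorem IsAhlforsRegular.measure_ball_lt_top (hμ : IsAhlforsRegular μ γ) (x : X) (r : ℝ) :
    μ (ball x r) < ∞ := by
  obtain ⟨c₁, c₂, -, -, h⟩ := hμ
  exact (measure_mono (ball_subset_ball (le_max_left r 1))).trans_lt
    ((h x (max r 1) (by positivity)).2.trans_lt ENNReal.ofReal_lt_top)

theorem IsAhlforsRegular.sigmaFinite (hμ : IsAhlforsRegular μ γ) : SigmaFinite μ := by
  rcases isEmpty_or_nonempty X with hX | ⟨⟨x⟩⟩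
  · rw [Measure.eq_zero_of_isEmpty μ]
    infer_instance
  · exact ⟨⟨{
      set := fun n => ball x n
      set_mem := fun _ => trivial
      finite := fun n => hμ.measure_ball_lt_top x n
      spanning := iUnion_ball_nat x }⟩⟩

theorem IsAhlforsRegular.isOpenPosMeasure (hμ : IsAhlforsRegular μ γ) : μ.IsOpenPosMeasure := by
  obtain ⟨c₁, c₂, hc₁, -, h⟩ := hμ
  refine ⟨fun U hU hne => ?_⟩
  obtain ⟨x, hx⟩ := hne
  obtain ⟨r, hr, hrU⟩ := Metric.isOpen_iff.1 hU x hx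
  have hball : 0 < μ (ball x r) :=
    (ENNReal.ofReal_pos.2 (by positivity)).trans_le (h x r hr).1
  exact (hball.trans_le (measure_mono hrU)).ne'

theorem IsAhlforsRegular.exists_measure_le_of_ediam_le (hμ : IsAhlforsRegular μ γ) {R : ℝ≥0∞}
    (hR : R ≠ ∞) : ∃ M : ℝ≥0∞, M ≠ ∞ ∧ ∀ s : Set X, ediam s ≤ R → μ s ≤ M := by
  obtain ⟨c₁, c₂, -, -, h⟩ := hμ
  refine ⟨ENNReal.ofReal (c₂ * (R.toReal + 1) ^ γ), ENNReal.ofReal_ne_top, fun s hs => ?_⟩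
  rcases s.eq_empty_or_nonempty with rfl | ⟨x, hx⟩
  · simp
  have hball : s ⊆ ball x (R.toReal + 1) := fun y hy => by
    have hxy := ENNReal.toReal_mono hR ((edist_le_ediam_of_mem hy hx).trans hs)
    rw [edist_dist, ENNReal.toReal_ofReal dist_nonneg] at hxy
    exact mem_ball.2 (by linarith)
  exact (measure_mono hball).trans (h x _ (by positivity)).2

theorem IsAhlforsRegular.exists_measure_ball_le_mul (hμ : IsAhlforsRegular μ γ)
    {L : ℝ} (hL : 0 < L) : ∃ C : ℝ≥0∞, C ≠ 0 ∧ C ≠ ∞ ∧ ∀ (x y : X) (r s : ℝ), 0 < s →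
      r ≤ L * s → μ (ball x r) ≤ C * μ (ball y s) := by
  obtain ⟨c₁, c₂, hc₁, hc₂, h⟩ := hμ
  have hC : 0 < c₂ * L ^ γ / c₁ := by positivity
  refine ⟨ENNReal.ofReal (c₂ * L ^ γ / c₁), by simpa using hC, ENNReal.ofReal_ne_top,
    fun x y r s hs hrs => ?_⟩
  calc μ (ball x r) ≤ μ (ball x (L * s)) := measure_mono (ball_subset_ball hrs)
    _ ≤ ENNReal.ofReal (c₂ * (L * s) ^ γ) := (h x _ (by positivity)).2
    _ = ENNReal.ofReal (c₂ * L ^ γ / c₁) * ENNReal.ofReal (c₁ * s ^ γ) := by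
        rw [← ENNReal.ofReal_mul hC.le, Real.mul_rpow hL.le hs.le]
        congr 1
        field_simp
    _ ≤ ENNReal.ofReal (c₂ * L ^ γ / c₁) * μ (ball y s) :=
        mul_le_mul_right (h y s hs).1 _

theorem IsAhlforsRegular.exists_measure_ball_dist_le_mul (hμ : IsAhlforsRegular μ γ) {a : ℝ}
    (ha : 0 < a) : ∃ C : ℝ≥0∞, C ≠ 0 ∧ C ≠ ∞ ∧ ∀ Q : Set X, ENNReal.ofReal a ≤ eccentricity Q →
      ∀ x ∈ Q, ∀ y ∈ Q, μ (ball x (dist x y)) ≤ C * μ Q := by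
  obtain ⟨C, hC₀, hC, hball⟩ := hμ.exists_measure_ball_le_mul (L := 4 / a) (by positivity)
  refine ⟨C, hC₀, hC, fun Q hQ x hx y hy => ?_⟩
  obtain ⟨x₁, x₂, r₁, r₂, hr₁, -, hsub, hsup, hr⟩ := exists_balls_of_lt_eccentricity <|
    ((ENNReal.ofReal_lt_ofReal_iff ha).2 (half_lt_self ha)).trans_le hQ
  have hdist : dist x y ≤ 4 / a * r₁ := calc
    dist x y ≤ r₂ + r₂ :=
      (dist_triangle_right x y x₂).trans (add_le_add (hsup hx).le (hsup hy).le)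
    _ = 4 / a * (a / 2 * r₂) := by field_simp; ring
    _ ≤ 4 / a * r₁ := by gcongr
  exact (hball x x₁ _ r₁ hr₁ hdist).trans (mul_le_mul_right (measure_mono hsub) C)

theorem IsAhlforsRegular.exists_dyadicEnergy_le_mul_metricEnergy (hμ : IsAhlforsRegular μ γ)
    {D : ℤ → Set (Set X)} {a : ℝ} (ha : 0 < a)
    (hecc : ∀ i, ∀ Q ∈ D i, ENNReal.ofReal a ≤ eccentricity Q) {σ : ℝ} (hσ : 0 ≤ 1 + 2 * σ) :
    ∃ C : ℝ≥0∞, C ≠ ∞ ∧ ∀ u, dyadicEnergy μ D σ u ≤ C * metricEnergy μ σ u := by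
  obtain ⟨C, hC₀, hC, hcube⟩ := hμ.exists_measure_ball_dist_le_mul ha
  refine ⟨C ^ (1 + 2 * σ), ENNReal.rpow_ne_top_of_nonneg hσ hC, fun u =>
    energy_le_mul_energy hσ hC₀ hC (fun x y => ?_) u⟩
  rcases eq_or_ne x y with rfl | hxy
  · simp
  · exact le_mul_dyadicDist hxy hC₀ hC fun i Q hQ hx hy => hcube Q (hecc i Q hQ) x hx y hy

theorem measurable_measure_ball_dist [OpensMeasurableSpace X] [SecondCountableTopology X]
    [SFinite μ] : Measurable (uncurry fun x y => μ (ball x (dist x y))) := by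
  have h : MeasurableSet {p : (X × X) × X | dist p.2 p.1.1 < dist p.1.1 p.1.2} :=
    (isOpen_lt (by fun_prop) (by fun_prop)).measurableSet
  exact measurable_measure_prodMk_left h

end Geometry

end DyadicCoercivity

open DyadicCoercivity in
theorem corollary3p4_general {X : Type*} [MetricSpace X] [MeasurableSpace X]
    [OpensMeasurableSpace X]
    {μ : Measure X} {γ : ℝ} (hμ : IsAhlforsRegular μ γ) {D : ℤ → Set (Set X)}
    (hmeas : ∀ i, ∀ Q ∈ D i, MeasurableSet Q) (hpart : ∀ i, Setoid.IsPartition (D i))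
    {a : ℝ} (ha : 0 < a) (hecc : ∀ i, ∀ Q ∈ D i, ENNReal.ofReal a ≤ eccentricity Q)
    {σ : ℝ} (hσ : 0 ≤ σ) {j : ℤ} {R : ℝ≥0∞} (hR : R ≠ ∞)
    (hdiam : ∀ Q ∈ D j, Metric.ediam Q ≤ R) :
    finiteEnergy (metricEnergy μ σ) ⊆ finiteEnergy (dyadicEnergy μ D σ) ∧
      IsHilbertSubspace (dyadicEnergy μ D σ)
        (finiteEnergy (dyadicEnergy μ D σ) ∩ levelKer μ D j) ∧
      IsCoerciveOn (metricEnergy μ σ) (finiteEnergy (dyadicEnergy μ D σ) ∩ levelKer μ D j) ∧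
      IsCoercivitySpace (metricEnergy μ σ)
        (finiteEnergy (metricEnergy μ σ) ∩ levelKer μ D j) := by
  have := hμ.sigmaFinite
  have := hμ.isOpenPosMeasure
  have := secondCountableTopology_of_isOpenPosMeasure μ
  have hint : ∀ i, ∀ Q ∈ D i, (interior Q).Nonempty := fun i Q hQ =>
    interior_nonempty_of_eccentricity_ne_zero ((ENNReal.ofReal_pos.2 ha).trans_le (hecc i Q hQ)).ne'
  have hcount : ∀ i, (D i).Countable := fun i =>
    (hpart i).pairwiseDisjoint.countable_of_nonempty_interior (hint i)
  obtain ⟨C, hC, hle⟩ := hμ.exists_dyadicEnergy_le_mul_metricEnergy ha hecc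
    (show 0 ≤ 1 + 2 * σ by positivity)
  obtain ⟨M, hM, hmeasure⟩ := hμ.exists_measure_le_of_ediam_le hR
  have hcoercive : IsCoerciveOn (metricEnergy μ σ) (levelKer μ D j) :=
    (isCoerciveOn_dyadicEnergy hσ (hpart j) (hmeas j)
      (fun Q hQ => (Measure.measure_pos_of_nonempty_interior μ (hint j Q hQ)).ne') hM
      (fun Q hQ => hmeasure Q (hdiam Q hQ))).of_le_mul hC hle
  have hclosed : IsClosed ((levelProj μ D j).ker : Set (Lp ℝ 2 μ)) :=
    (levelProj μ D j).isClosed_ker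
  exact ⟨finiteEnergy_subset_of_le_mul hC hle,
    isHilbertSubspace_finiteEnergy_inter (measurable_dyadicDist hcount hmeas) hclosed,
    hcoercive.mono Set.inter_subset_right,
    isHilbertSubspace_finiteEnergy_inter measurable_measure_ball_dist hclosed,
    hcoercive.mono Set.inter_subset_right⟩

theorem corollary3p4 {X : Type*} [MetricSpace X] [MeasurableSpace X] [BorelSpace X]
    (μ : Measure X) (γ : ℝ) (hγ : 0 < γ) (hμ : DyadicCoercivity.IsAhlforsRegular μ γ)
    (D : ℤ → Set (Set X)) (hD : DyadicCoercivity.IsDyadicFamily D)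
    (σ : ℝ) (hσ : 0 < σ) (j : ℤ) :
    DyadicCoercivity.finiteEnergy (DyadicCoercivity.metricEnergy μ σ) ⊆
        DyadicCoercivity.finiteEnergy (DyadicCoercivity.dyadicEnergy μ D σ) ∧
      DyadicCoercivity.IsHilbertSubspace (DyadicCoercivity.dyadicEnergy μ D σ)
        (DyadicCoercivity.finiteEnergy (DyadicCoercivity.dyadicEnergy μ D σ) ∩
          DyadicCoercivity.levelKer μ D j) ∧
      DyadicCoercivity.IsCoerciveOn (DyadicCoercivity.metricEnergy μ σ)
        (DyadicCoercivity.finiteEnergy (DyadicCoercivity.dyadicEnergy μ D σ) ∩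
          DyadicCoercivity.levelKer μ D j) ∧
      DyadicCoercivity.IsCoercivitySpace (DyadicCoercivity.metricEnergy μ σ)
        (DyadicCoercivity.finiteEnergy (DyadicCoercivity.metricEnergy μ σ) ∩
          DyadicCoercivity.levelKer μ D j) := by
  obtain ⟨_, _, _, -, -, -, -, hdiam⟩ := hD.diam
  obtain ⟨_, _, ha, -, hecc⟩ := hD.ecc
  exact corollary3p4_general hμ hD.measurable hD.partition ha (fun i Q hQ => (hecc i Q hQ).1)
    hσ.le ENNReal.ofReal_ne_top fun Q hQ => (hdiam j Q hQ).2
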